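/- Let $n\ge 1$ and order $\mathbb{R}^n$ by $u\preceq v$ iff $u_j\le v_j$ for all $j$. Let $K$ be a finite abstract simplicial complex (simplices are non-empty) and let $\{K^u\}_{u\in\mathbb{R}^n}$ be a filtration of $K$: subcomplexes with $K^u\subseteq K^v$ whenever $u\preceq v$, and $\bigcup_u K^u=K$. Assume that the filtration is tame and one-critical: every simplex $\sigma$ of $K$ has a unique entrance value $f(\sigma)\in\mathbb{R}^n$, and $\sigma\in K^u$ if and only if $f(\sigma)\preceq u$. Let $V$ be a discrete gradient vector field on $K$ consistent with the filtration, that is, for all $(\sigma,\tau)\in V$ and all $u$, $\sigma\in K^u$ if and only if $\tau\in K^u$. Let $C$ be the set of entrance values of the simplices of $K$ that are critical for $V$ (in no pair of $V$), and let $\overline{C}$ be its closure under least upper bounds. For $u\in\mathbb{R}^n$ put $\bar u=\max\{c\in\overline{C} : c\preceq u\}$ when this set is non-empty. Let $\mathbb{K}$ be a field and $i$ an integer, and let $\mathbb{V}=H_i(K^{\bullet};\mathbb{K})$ be the $n$-parameter persistence module given by simplicial homology, with transition maps induced by inclusions. Let $L=\{\vec m s+u_0: s\in\mathbb{R}\}$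 and $L'=\{\vec m' s'+u_0': s'\in\mathbb{R}\}$ be parametrized lines of positive slope, that is, all coordinates of $\vec m$ and $\vec m'$ are positive. For $u\in\mathbb{R}^n$ let $S_+(u)=\{x : u\preceq x\}$, and let $\mathrm{push}_L(u)$ be the unique point of $L\cap\partial S_+(u)$. For $\varnothing\ne A\subseteq\{1,\dots,n\}$ let $S_A(u)=\{x : x_j=u_j \text{ for } j\in A,\ x_j>u_j\text{ for }j\notin A\}$; these sets are the open faces of $\partial S_+(u)$. Assume that $L$ and $L'$ have the same reciprocal position with respect to $\overline{C}$: for each $u\in\overline{C}$, the points $\mathrm{push}_L(u)$ and $\mathrm{push}_{L'}(u)$ lie on the same open face of $\partial S_+(u)$. Let $\mathbb{V}_L$ be the restriction of $\mathbb{V}$ to $L$, a persistence module over $\mathbb{R}$ by means of the parametrization, and similarly $\mathbb{V}_{L'}$. For a persistence module $\mathbb{W}$ over $\mathbb{R}$ let $\rho(s,t)$, $s\le t$, be the rank of its transition map from $s$ to $t$, and define, for real $s<t$, $$\mu_{\mathbb{W}}(s,t)=\min_{e>0,\ s+e<t-e}\bigl(\rho(s+e,t-e)-\rho(s-e,t-e)-\rho(s+e,t+e)+\rho(s-e,t+e)\bigr),$$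 $$\mu_{\mathbb{W}}(s,\infty)=\min_{e>0,\ v\ge s+e}\bigl(\rho(s+e,v)-\rho(s-e,v)\bigr).$$ The persistence diagram $\mathrm{dgm}(\mathbb{W})$ is the set of all $(s,t)$ with $s\in\mathbb{R}$, $t\in\mathbb{R}\cup\{\infty\}$, $s<t$ and $\mu_{\mathbb{W}}(s,t)>0$, each point being taken with multiplicity $\mu_{\mathbb{W}}(s,t)$. Then there is a bijection $\gamma:\mathrm{dgm}(\mathbb{V}_L)\to\mathrm{dgm}(\mathbb{V}_{L'})$ that preserves multiplicities and such that, for each $(s,t)\in\mathrm{dgm}(\mathbb{V}_L)$, with $\gamma(s,t)=(s',t')$: - $\overline{\vec m s+u_0}$ exists and $\vec m's'+u_0'=\mathrm{push}_{L'}\bigl(\overline{\vec m s+u_0}\bigr)$; - if $t\in\mathbb{R}$, then $t'\in\mathbb{R}$, $\overline{\vec m t+u_0}$ exists and $\vec m't'+u_0'=\mathrm{push}_{L'}\bigl(\overline{\vec m t+u_0}\bigr)$; if $t=\infty$, then $t'=\infty$. -/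

import Mathlib

noncomputable section

namespace MorsePersistence

/-! ### Persistence modules -/

universe w

/-- A persistence module over an ordered parameter space `P`. -/
structure PersistenceModule (𝕜 : Type*) [Field 𝕜] (P : Type*) [Preorder P] where
  /-- The vector space at each parameter. -/
  space : P → Type w
  [addCommGroup : ∀ u, AddCommGroup (space u)]
  [module : ∀ u, Module 𝕜 (space u)]
  /-- The transition maps. -/
  map : ∀ {u v : P}, u ≤ v → space u →ₗ[𝕜] space v
  map_refl : ∀ u : P, map (le_refl u) = LinearMap.id
  map_trans : ∀ {u v w : P} (h : u ≤ v) (h' : v ≤ w), map h' ∘ₗ map h = map (h.trans h')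

attribute [instance] PersistenceModule.addCommGroup PersistenceModule.module

/-- The pullback of a persistence module along a monotone map of parameter spaces. -/
def PersistenceModule.pullback {𝕜 : Type*} [Field 𝕜] {P Q : Type*} [Preorder P] [Preorder Q]
    (M : PersistenceModule 𝕜 Q) (f : P → Q) (hf : Monotone f) : PersistenceModule 𝕜 P where
  space u := M.space (f u)
  map h := M.map (hf h)
  map_refl u := M.map_refl (f u)
  map_trans h h' := M.map_trans (hf h) (hf h')

/-! ### Simplicial homology with coefficients in a field -/

section Homology

variable (𝕜 : Type*) [Field 𝕜] {ι : Type*}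

/-- The space of simplicial `p`-chains of `K`: the linear combinations of simplices of `K` with
`p + 1` vertices, as functions of the set of vertices. It is zero for `p < 0`, as simplices are
nonempty. -/
def chains (K : PreAbstractSimplicialComplex ι) (p : ℤ) : Submodule 𝕜 (Finset ι → 𝕜) where
  carrier := {c | ∀ σ, c σ ≠ 0 → σ ∈ K ∧ (σ.card : ℤ) = p + 1}
  zero_mem' := fun _ h => absurd rfl h
  add_mem' := fun {a b} ha hb σ h => by
    by_cases h' : a σ = 0
    · exact hb σ fun h'' => h (by simp [h', h''])
    · exact ha σ h'
  smul_mem' := fun _ _ hb σ h => hb σ fun h' => h (by simp [h'])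

theorem chains_mono {K K' : PreAbstractSimplicialComplex ι} (h : K ≤ K') (p : ℤ) :
    chains 𝕜 K p ≤ chains 𝕜 K' p :=
  fun _ hc σ hσ => ⟨h (hc σ hσ).1, (hc σ hσ).2⟩

variable [Fintype ι] [LinearOrder ι]

/-- The simplicial boundary, on linear combinations of finite sets of vertices. The vertices are
ordered in order to fix signs: the face that omits `v` has the sign given by the number of vertices
before `v`. The boundary of a vertex is zero. -/
def boundary : (Finset ι → 𝕜) →ₗ[𝕜] (Finset ι → 𝕜) :=
  Fintype.linearCombination 𝕜 fun σ : Finset ι =>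
    if σ.card ≤ 1 then 0
    else ∑ v ∈ σ, (-1 : 𝕜) ^ (σ.filter (· < v)).card • Pi.single (σ.erase v) (1 : 𝕜)

/-- The space of `p`-cycles. -/
def cycles (K : PreAbstractSimplicialComplex ι) (p : ℤ) : Submodule 𝕜 (Finset ι → 𝕜) :=
  chains 𝕜 K p ⊓ LinearMap.ker (boundary 𝕜)

/-- The space of `p`-boundaries. -/
def boundaries (K : PreAbstractSimplicialComplex ι) (p : ℤ) : Submodule 𝕜 (Finset ι → 𝕜) :=
  (chains 𝕜 K (p + 1)).map (boundary 𝕜)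

theorem cycles_mono {K K' : PreAbstractSimplicialComplex ι} (h : K ≤ K') (p : ℤ) :
    cycles 𝕜 K p ≤ cycles 𝕜 K' p :=
  inf_le_inf_right _ (chains_mono 𝕜 h p)

theorem boundaries_mono {K K' : PreAbstractSimplicialComplex ι} (h : K ≤ K') (p : ℤ) :
    boundaries 𝕜 K p ≤ boundaries 𝕜 K' p :=
  Submodule.map_mono (chains_mono 𝕜 h (p + 1))

/-- The `p`-th simplicial homology space: cycles modulo boundaries. -/
abbrev Homology (K : PreAbstractSimplicialComplex ι) (p : ℤ) :=
  cycles 𝕜 K p ⧸ (boundaries 𝕜 K p).submoduleOf (cycles 𝕜 K p)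

/-- The map induced in homology by an inclusion of complexes. -/
def homologyMap {K K' : PreAbstractSimplicialComplex ι} (h : K ≤ K') (p : ℤ) :
    Homology 𝕜 K p →ₗ[𝕜] Homology 𝕜 K' p :=
  Submodule.mapQ _ _ (Submodule.inclusion (cycles_mono 𝕜 h p))
    fun _ hx => boundaries_mono 𝕜 h p hx

/-- The persistence module of simplicial homology in degree `p`, over the complexes with vertices in
`ι` ordered by inclusion. -/
def homologyModule (p : ℤ) : PersistenceModule 𝕜 (PreAbstractSimplicialComplex ι) where
  space K := Homology 𝕜 K p
  map h := homologyMap 𝕜 h p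
  map_refl K := by
    ext x
    rfl
  map_trans h h' := by
    ext x
    rfl

end Homology

/-! ### Filtrations and persistent homology -/

section Filtrations

variable {ι : Type*}

/-- An `n`-parameter filtration of `K`: an increasing family of subcomplexes with union `K`. The
order on `Fin n → ℝ` is the coordinatewise one. -/
structure Filtration (K : AbstractSimplicialComplex ι) (n : ℕ) where
  /-- The subcomplexes. -/
  sub : (Fin n → ℝ) →o PreAbstractSimplicialComplex ι
  /-- Their union is `K`. -/
  mem_iff : ∀ σ : Finset ι, σ ∈ K ↔ ∃ u, σ ∈ sub u

namespace Filtration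

variable {K : AbstractSimplicialComplex ι} {n : ℕ} (F : Filtration K n)

/-- `u` is an entrance value of the simplex `σ`. -/
def IsEntranceValue (σ : Finset ι) (u : Fin n → ℝ) : Prop :=
  σ ∈ F.sub u ∧ ∀ w ≤ u, w ≠ u → σ ∉ F.sub w

/-- The filtration is tame and one-critical: each simplex has exactly one entrance value, and it
enters the filtration only there, so that it is present exactly at the parameters above its
entrance value (the filtration is the sublevel set filtration of a function). -/
def IsTameOneCritical : Prop :=
  ∀ σ ∈ K, ∃ u, F.IsEntranceValue σ u ∧ ∀ v, σ ∈ F.sub v → u ≤ v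

/-- The persistent homology module of the filtration in degree `i`. -/
def persistentHomology (𝕜 : Type*) [Field 𝕜] [Fintype ι] [LinearOrder ι] (i : ℤ) :
    PersistenceModule 𝕜 (Fin n → ℝ) :=
  (homologyModule 𝕜 i).pullback F.sub F.sub.monotone

end Filtration

/-! ### Discrete gradient vector fields -/

/-- `α` is a face of `β` of codimension one. -/
def IsFacet (α β : Finset ι) : Prop :=
  α ⊆ β ∧ α.card + 1 = β.card

/-- `V` is a discrete vector field on `K`: a set of pairs of simplices, the first one a facet of the
second one, such that each simplex is in at most one pair. -/
structure IsDiscreteVectorField (K : AbstractSimplicialComplex ι)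
    (V : Set (Finset ι × Finset ι)) : Prop where
  left_mem : ∀ p ∈ V, p.1 ∈ K
  right_mem : ∀ p ∈ V, p.2 ∈ K
  isFacet : ∀ p ∈ V, IsFacet p.1 p.2
  unique : ∀ p ∈ V, ∀ q ∈ V, ∀ σ, (σ = p.1 ∨ σ = p.2) → (σ = q.1 ∨ σ = q.2) → p = q

/-- `α 0, β 0, α 1, β 1, …, β r, α (r + 1)` is a `V`-path. -/
def IsVPath (V : Set (Finset ι × Finset ι)) (r : ℕ) (α β : ℕ → Finset ι) : Prop :=
  ∀ k ≤ r, (α k, β k) ∈ V ∧ IsFacet (α (k + 1)) (β k) ∧ α (k + 1) ≠ α k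

/-- `V` is a discrete gradient vector field on `K`: a discrete vector field without non-trivial
closed paths. -/
structure IsDiscreteGradient (K : AbstractSimplicialComplex ι)
    (V : Set (Finset ι × Finset ι)) : Prop extends IsDiscreteVectorField K V where
  acyclic : ∀ (r : ℕ) (α β : ℕ → Finset ι), 0 < r → IsVPath V r α β → α 0 ≠ α (r + 1)

/-- `σ` is a critical simplex of `V`: it is in no pair of `V`. -/
def IsCritical (K : AbstractSimplicialComplex ι) (V : Set (Finset ι × Finset ι))
    (σ : Finset ι) : Prop :=
  σ ∈ K ∧ ∀ p ∈ V, σ ≠ p.1 ∧ σ ≠ p.2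

namespace Filtration

variable {K : AbstractSimplicialComplex ι} {n : ℕ} (F : Filtration K n)

/-- `V` is consistent with the filtration: paired simplices are present at the same parameters. -/
def IsConsistent (V : Set (Finset ι × Finset ι)) : Prop :=
  ∀ p ∈ V, ∀ u, p.1 ∈ F.sub u ↔ p.2 ∈ F.sub u

/-- The critical values: the entrance values of the critical simplices. -/
def criticalValues (V : Set (Finset ι × Finset ι)) : Set (Fin n → ℝ) :=
  {u | ∃ σ, IsCritical K V σ ∧ F.IsEntranceValue σ u}

/-- The closure of the set of critical values under least upper bounds. -/
def closedCriticalValues (V : Set (Finset ι × Finset ι)) : Set (Fin n → ℝ) :=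
  supClosure (F.criticalValues V)

end Filtration

end Filtrations

/-! ### Rank invariant and persistence diagram -/

section Diagram

variable {𝕜 : Type*} [Field 𝕜]

/-- The rank invariant of a persistence module, defined on comparable pairs. -/
def rankInv {P : Type*} [Preorder P] (M : PersistenceModule 𝕜 P) (u v : P) (h : u ≤ v) : ℤ :=
  Module.finrank 𝕜 (LinearMap.range (M.map h))

/-- The multiplicity of a finite point `(s, t)`, where `s < t`: the minimum over `e` of the
alternating sum of ranks. These are nonnegative integers for the modules of interest, so that the
infimum is attained. -/
def multFinite (M : PersistenceModule 𝕜 ℝ) (s t : ℝ) : ℤ :=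
  sInf {k | ∃ (e : ℝ) (he : 0 < e) (h : s + e < t - e),
    k = rankInv M (s + e) (t - e) h.le - rankInv M (s - e) (t - e) (by linarith)
      - rankInv M (s + e) (t + e) (by linarith) + rankInv M (s - e) (t + e) (by linarith)}

/-- The multiplicity of a point `(s, ∞)`: the minimum, over all `e` and `v` for which the ranks are
defined, of the difference of ranks. -/
def multInfinite (M : PersistenceModule 𝕜 ℝ) (s : ℝ) : ℤ :=
  sInf {k | ∃ (e v : ℝ) (he : 0 < e) (h : s + e ≤ v),
    k = rankInv M (s + e) v h - rankInv M (s - e) v (by linarith)}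

/-- The multiplicity of a point `(s, t)`, where `t` may be infinite. -/
def mult (M : PersistenceModule 𝕜 ℝ) (p : ℝ × WithTop ℝ) : ℤ :=
  WithTop.recTopCoe (multInfinite M p.1) (fun t => multFinite M p.1 t) p.2

/-- The set of points of the persistence diagram: the points above the diagonal, some of them at
infinity, with positive multiplicity. The diagram is this set with the multiplicities `mult M`. -/
def dgm (M : PersistenceModule 𝕜 ℝ) : Set (ℝ × WithTop ℝ) :=
  {p | (p.1 : WithTop ℝ) < p.2 ∧ 0 < mult M p}

end Diagram

/-! ### Lines of positive slope -/

/-- The open face, indexed by `A`, of the boundary of the positive cone of `u`. -/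
def openFace {n : ℕ} (A : Set (Fin n)) (u : Fin n → ℝ) : Set (Fin n → ℝ) :=
  {x | (∀ i ∈ A, x i = u i) ∧ ∀ j ∉ A, u j < x j}

/-- A parametrized line `s ↦ s • dir + base` with positive slope. -/
structure PositiveLine (n : ℕ) where
  /-- The starting point. -/
  base : Fin n → ℝ
  /-- The velocity vector. -/
  dir : Fin n → ℝ
  /-- All coordinates of the velocity vector are positive. -/
  dir_pos : ∀ i, 0 < dir i

namespace PositiveLine

variable {n : ℕ}

/-- The point with parameter `s`. -/
def point (L : PositiveLine n) (s : ℝ) : Fin n → ℝ :=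
  s • L.dir + L.base

theorem monotone_point (L : PositiveLine n) : Monotone L.point := fun s t h i => by
  simp only [point, Pi.add_apply, Pi.smul_apply, smul_eq_mul]
  have := mul_le_mul_of_nonneg_right h (L.dir_pos i).le
  linarith

/-- The restriction of an `n`-parameter persistence module to a line, as a one-parameter persistence
module. -/
def restrict {𝕜 : Type*} [Field 𝕜] (L : PositiveLine n) (M : PersistenceModule 𝕜 (Fin n → ℝ)) :
    PersistenceModule 𝕜 ℝ :=
  M.pullback L.point L.monotone_point

/-- A point is on the boundary of the positive cone of `u` if and only if it is above `u` and has
some coordinate in common with `u`. -/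
theorem mem_frontier_Ici {u x : Fin n → ℝ} :
    x ∈ frontier (Set.Ici u) ↔ u ≤ x ∧ ∃ i, x i = u i := by
  have hI : interior (Set.Ici u) = {x | ∀ i, u i < x i} := by
    rw [← Set.pi_univ_Ici, interior_pi_set Set.finite_univ]
    ext y
    simp
  rw [isClosed_Ici.frontier_eq, hI]
  simp only [Set.mem_sdiff, Set.mem_Ici, Set.mem_ofPred_eq, not_forall, not_lt]
  exact and_congr_right fun h =>
    exists_congr fun i => ⟨fun h' => le_antisymm h' (h i), fun h' => h'.le⟩

/-- A line with positive slope meets the boundary of a positive cone in exactly one point. -/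
theorem existsUnique_push [NeZero n] (L : PositiveLine n) (u : Fin n → ℝ) :
    ∃! x, x ∈ Set.range L.point ∩ frontier (Set.Ici u) := by
  have key : ∀ (t : ℝ) (i : Fin n),
      L.point t i - u i = L.dir i * (t - (u i - L.base i) / L.dir i) := fun t i => by
    have := (L.dir_pos i).ne'
    simp only [point, Pi.add_apply, Pi.smul_apply, smul_eq_mul]
    field_simp
    ring
  obtain ⟨j, -, hj⟩ := Finset.univ.exists_max_image
    (fun i => (u i - L.base i) / L.dir i) ⟨(0 : Fin n), Finset.mem_univ _⟩
  refine ⟨L.point ((u j - L.base j) / L.dir j), ⟨⟨_, rfl⟩, mem_frontier_Ici.2 ⟨fun i => ?_, j, ?_⟩⟩,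
    ?_⟩
  · have h1 := key ((u j - L.base j) / L.dir j) i
    have h2 := mul_nonneg (L.dir_pos i).le (sub_nonneg.2 (hj i (Finset.mem_univ i)))
    linarith
  · have h1 := key ((u j - L.base j) / L.dir j) j
    rw [sub_self, mul_zero] at h1
    linarith
  · rintro _ ⟨⟨t, rfl⟩, ht⟩
    obtain ⟨hle, i, hi⟩ := mem_frontier_Ici.1 ht
    have h1 := key t i
    rw [hi, sub_self, eq_comm, mul_eq_zero, or_iff_right (L.dir_pos i).ne'] at h1
    have h2 := key t j
    have h3 : 0 ≤ t - (u j - L.base j) / L.dir j := by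
      refine nonneg_of_mul_nonneg_right ?_ (L.dir_pos j)
      rw [← h2]
      exact sub_nonneg.2 (hle j)
    have h4 := hj i (Finset.mem_univ i)
    congr 1
    linarith

/-- The push of `u` along the line: the intersection point of the line with the boundary of the
positive cone of `u`. -/
def push [NeZero n] (L : PositiveLine n) (u : Fin n → ℝ) : Fin n → ℝ :=
  (L.existsUnique_push u).choose

/-- The lines have the same reciprocal position with respect to each point of `U`: the pushes of the
point to the two lines are on the same open face of the boundary of its positive cone. -/
def SameReciprocalPosition [NeZero n] (L L' : PositiveLine n) (U : Set (Fin n → ℝ)) : Prop :=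
  ∀ u ∈ U, ∃ A : Set (Fin n), A.Nonempty ∧ L.push u ∈ openFace A u ∧ L'.push u ∈ openFace A u

end PositiveLine

/-- `b` is the bar of `u` with respect to `U`: the maximum of the points of `U` below `u`. -/
def IsBar {n : ℕ} (U : Set (Fin n → ℝ)) (u b : Fin n → ℝ) : Prop :=
  IsGreatest {u' | u' ∈ U ∧ u' ≤ u} b

end MorsePersistence

end

noncomputable section

namespace MorsePersistence

/-! ### The boundary operator -/

section Boundary

/-! A consistent gradient field pairs all simplices that are not critical. If `u ≤ v` and the same
critical simplices are present at both, then the simplices added between `u` and `v` form a union of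
pairs. Acyclicity allows these pairs to be collapsed one at a time, and each collapse induces an
isomorphism in homology. Hence the rank between two parameters depends only on which critical values
lie below each of them (`IsDiscreteGradient.rankInv_persistentHomology_eq`).

On a line, `c` lies below the point with parameter `t` exactly when `L.param c ≤ t`, so ranks along
the line depend only on how the parameters compare with those of the pushes. Lines in the same
reciprocal position push the points of the closure in the same weak order
(`SameReciprocalPosition.param_le_param`). Closure under least upper bounds enters here, through the
face that contains the push of `b ⊔ c`. The correspondence of push parameters is therefore a
well-defined order isomorphism `φ`.

Multiplicities are values of alternating sums of ranks for small `e`, so `φ` preserves them. Ranks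
are locally constant away from the pushes of critical values, so finite coordinates of diagram
points are in the domain of `φ`, and `γ` applies `φ` to them. The bar of the push of `c` need not be
`c`, but both have the same push to `L`, hence to `L'`. -/

theorem erase_filter_comm {ι : Type*} [DecidableEq ι] (σ : Finset ι) (p : ι → Prop)
    [DecidablePred p] (v : ι) : (σ.filter p).erase v = (σ.erase v).filter p := by
  ext
  simp only [Finset.mem_erase, Finset.mem_filter, and_assoc]

variable (𝕜 : Type*) [Field 𝕜] {ι : Type*} [LinearOrder ι]

theorem faceSign_erase_of_lt {σ : Finset ι} {v w : ι} (hv : v ∈ σ) (h : v < w) :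
    (-1 : 𝕜) ^ (σ.filter (· < w)).card = -(-1) ^ ((σ.erase v).filter (· < w)).card := by
  rw [← erase_filter_comm, ← Finset.card_erase_add_one (s := σ.filter (· < w)) (a := v)
    (by simp [hv, h]), pow_succ]
  ring

theorem faceSign_erase_of_gt {σ : Finset ι} {v w : ι} (h : v < w) :
    (-1 : 𝕜) ^ ((σ.erase w).filter (· < v)).card = (-1) ^ (σ.filter (· < v)).card := by
  rw [← erase_filter_comm, Finset.erase_eq_of_notMem (by simp [h.le])]

/-- Omitting the smaller vertex shifts the position of the larger one by one, while omitting the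
larger one leaves the position of the smaller unchanged; so the two orders of omission have opposite
signs. -/
theorem faceSign_mul_faceSign {σ : Finset ι} {v w : ι} (hv : v ∈ σ) (hw : w ∈ σ) (h : v ≠ w) :
    (-1 : 𝕜) ^ (σ.filter (· < v)).card * (-1) ^ ((σ.erase v).filter (· < w)).card +
      (-1 : 𝕜) ^ (σ.filter (· < w)).card * (-1) ^ ((σ.erase w).filter (· < v)).card = 0 := by
  rcases h.lt_or_gt with h | h
  · rw [faceSign_erase_of_lt 𝕜 hv h, faceSign_erase_of_gt 𝕜 h]
    ring
  · rw [faceSign_erase_of_lt 𝕜 hw h, faceSign_erase_of_gt 𝕜 h]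
    ring

theorem sum_sum_faceSign (σ : Finset ι) :
    ∑ v ∈ σ, (-1 : 𝕜) ^ (σ.filter (· < v)).card • ∑ w ∈ σ.erase v,
      (-1 : 𝕜) ^ ((σ.erase v).filter (· < w)).card •
        (Pi.single ((σ.erase v).erase w) (1 : 𝕜) : Finset ι → 𝕜) = 0 := by
  simp_rw [Finset.smul_sum, smul_smul]
  rw [Finset.sum_sigma']
  refine Finset.sum_involution (fun p _ => ⟨p.2, p.1⟩) ?_ ?_ ?_ ?_
  · rintro ⟨v, w⟩ h
    simp only [Finset.mem_sigma, Finset.mem_erase] at h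
    simp only
    rw [Finset.erase_right_comm (a := w), ← add_smul,
      faceSign_mul_faceSign 𝕜 h.1 h.2.2 (Ne.symm h.2.1), zero_smul]
  · rintro ⟨v, w⟩ h - h'
    simp only [Finset.mem_sigma, Finset.mem_erase] at h
    simp only [Sigma.mk.injEq] at h'
    exact h.2.1 h'.1
  · rintro ⟨v, w⟩ h
    simp only [Finset.mem_sigma, Finset.mem_erase] at h ⊢
    exact ⟨h.2.2, Ne.symm h.2.1, h.1⟩
  · rintro ⟨v, w⟩ h
    rfl

variable [Fintype ι]

theorem boundary_single (σ : Finset ι) :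
    boundary 𝕜 (Pi.single σ 1) = if σ.card ≤ 1 then 0
      else ∑ v ∈ σ, (-1 : 𝕜) ^ (σ.filter (· < v)).card • Pi.single (σ.erase v) (1 : 𝕜) := by
  rw [boundary, Fintype.linearCombination_apply_single, one_smul]

/-- The boundary of the boundary of a simplex is zero. -/
theorem boundary_boundary_single (σ : Finset ι) :
    boundary 𝕜 (boundary 𝕜 (Pi.single σ 1)) = 0 := by
  rw [boundary_single]
  split_ifs with h
  · exact map_zero _
  simp_rw [map_sum, map_smul, boundary_single]
  -- For an edge nothing cancels: the boundaries of the vertices are zero by convention, since the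
  -- empty set is not a simplex.
  by_cases h2 : σ.card = 2
  · refine Finset.sum_eq_zero fun v hv => ?_
    rw [if_pos (by rw [Finset.card_erase_of_mem hv]; omega), smul_zero]
  · rw [← sum_sum_faceSign 𝕜 σ]
    refine Finset.sum_congr rfl fun v hv => ?_
    rw [if_neg (by rw [Finset.card_erase_of_mem hv]; omega)]

variable {𝕜}

theorem boundary_apply (c : Finset ι → 𝕜) (σ : Finset ι) :
    boundary 𝕜 c σ = ∑ ρ, c ρ * boundary 𝕜 (Pi.single ρ 1) σ := by
  simp_rw [boundary, Fintype.linearCombination_apply_single, one_smul,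
    Fintype.linearCombination_apply, Finset.sum_apply, Pi.smul_apply, smul_eq_mul]

theorem isFacet_of_boundary_single_ne_zero {σ ρ : Finset ι}
    (h : boundary 𝕜 (Pi.single ρ 1) σ ≠ 0) : IsFacet σ ρ ∧ σ.Nonempty := by
  rw [boundary_single] at h
  split_ifs at h with h1
  · exact absurd rfl h
  rw [Finset.sum_apply] at h
  obtain ⟨v, hv, h2⟩ := Finset.exists_ne_zero_of_sum_ne_zero h
  have h3 : σ = ρ.erase v := by
    by_contra h3
    simp [h3] at h2
  have h4 := Finset.card_erase_add_one hv
  subst h3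
  exact ⟨⟨Finset.erase_subset _ _, h4⟩, Finset.card_pos.1 (by omega)⟩

/-- The coefficient is a sign, since exactly one vertex of `τ` can be omitted to give `σ`.
Nonemptiness of `σ` excludes the case where `τ` is a vertex, whose boundary is zero. -/
theorem boundary_single_ne_zero {σ τ : Finset ι} (h : IsFacet σ τ) (hσ : σ.Nonempty) :
    boundary 𝕜 (Pi.single τ 1) σ ≠ 0 := by
  have hpos := hσ.card_pos
  obtain ⟨v, hv, rfl⟩ := (Finset.covBy_iff_exists_insert (s := σ) (t := τ)).1
    (Finset.covBy_iff_card_sdiff_eq_one.2 ⟨h.1, by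
      rw [Finset.card_sdiff_of_subset h.1, ← h.2]; omega⟩)
  rw [boundary_single, if_neg (by rw [← h.2]; omega), Finset.sum_apply,
    Finset.sum_eq_single v]
  · simp [Finset.erase_insert hv]
  · intro w hw hwv
    have : σ ≠ (insert v σ).erase w := fun h' => hv (by
      rw [h']; exact Finset.mem_erase.2 ⟨Ne.symm hwv, Finset.mem_insert_self _ _⟩)
    simp [this]
  · intro h'
    exact absurd (Finset.mem_insert_self _ _) h'

end Boundary

/-! ### Elementary collapses -/

section Collapse

variable {ι : Type*}

theorem nonempty_of_mem {K : PreAbstractSimplicialComplex ι} {σ : Finset ι} (h : σ ∈ K) :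
    σ.Nonempty :=
  (K.isRelLowerSet_faces h).1

theorem mem_of_subset {K : PreAbstractSimplicialComplex ι} {σ τ : Finset ι} (h : τ ∈ K)
    (h' : σ ⊆ τ) (hσ : σ.Nonempty) : σ ∈ K :=
  (K.isRelLowerSet_faces h).2 h' hσ

/-- `B` is obtained from `B'` by adding the simplex `τ` and its free facet `σ`. -/
structure IsElementaryExpansion (B' B : PreAbstractSimplicialComplex ι) (σ τ : Finset ι) :
    Prop where
  isFacet : IsFacet σ τ
  left_mem : σ ∈ B
  right_mem : τ ∈ B
  mem_iff : ∀ ρ, ρ ∈ B' ↔ ρ ∈ B ∧ ρ ≠ σ ∧ ρ ≠ τ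
  eq_of_isFacet : ∀ ρ ∈ B, IsFacet σ ρ → ρ = τ

theorem IsElementaryExpansion.le {B' B : PreAbstractSimplicialComplex ι} {σ τ : Finset ι}
    (h : IsElementaryExpansion B' B σ τ) : B' ≤ B :=
  fun _ hρ => ((h.mem_iff _).1 hρ).1

/-- A nonempty set of pairs of a gradient vector field contains a pair that is preceded by no
other one. -/
theorem IsDiscreteGradient.exists_isFacet_imp_eq [Fintype ι] {K : AbstractSimplicialComplex ι}
    {V : Set (Finset ι × Finset ι)} (hV : IsDiscreteGradient K V)
    {W : Set (Finset ι × Finset ι)} (hW : W ⊆ V) (hne : W.Nonempty) :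
    ∃ p ∈ W, ∀ q ∈ W, IsFacet p.1 q.2 → q = p := by
  by_contra! hcon
  -- `g` maps each pair of `W` to a different one whose upper simplex has the given lower simplex as
  -- a facet. Iterating `g` must repeat a pair, and the orbit read backwards is a closed `V`-path.
  choose! g hg1 hg2 hg3 using hcon
  obtain ⟨p, hp⟩ := hne
  have hit : ∀ k, g^[k] p ∈ W := fun k => by
    induction k with
    | zero => exact hp
    | succ k ih =>
      rw [Function.iterate_succ_apply']
      exact hg1 _ ih
  obtain ⟨a, b, hab, heq⟩ : ∃ a b, a < b ∧ g^[a] p = g^[b] p := by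
    obtain ⟨a, b, hab, heq⟩ := Finite.exists_ne_map_eq_of_infinite fun k : ℕ => g^[k] p
    rcases hab.lt_or_gt with h | h
    · exact ⟨a, b, h, heq⟩
    · exact ⟨b, a, h, heq.symm⟩
  have hpath : IsVPath V (b - a - 1) (fun k => (g^[b - k] p).1) fun k => (g^[b - k] p).2 := by
    intro k hk
    have hk' : b - k = b - (k + 1) + 1 := by omega
    have h1 := hit (b - (k + 1))
    refine ⟨hW (hit _), ?_, fun h => hg3 _ h1 ?_⟩
    · simp only [hk', Function.iterate_succ_apply']
      exact hg2 _ h1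
    · simp only [hk', Function.iterate_succ_apply'] at h
      exact hV.unique _ (hW (hg1 _ h1)) _ (hW h1) _ (.inl rfl) (.inl h.symm)
  have hend : (g^[b - 0] p).1 = (g^[b - (b - a - 1 + 1)] p).1 := by
    rw [show b - (b - a - 1 + 1) = a by omega, heq]
    rfl
  -- Acyclicity speaks only of paths with `0 < r`; for `r = 0` a path cannot close because
  -- consecutive lower simplices differ.
  rcases Nat.eq_zero_or_pos (b - a - 1) with h0 | h0
  · rw [h0] at hend
    exact (hpath 0 (Nat.zero_le _)).2.2 hend.symm
  · exact hV.acyclic _ _ _ h0 hpath hend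

/-- If the simplices of `B` that are not in `A` are a nonempty union of pairs of a gradient vector
field, then one of these pairs can be collapsed. -/
theorem IsDiscreteGradient.exists_isElementaryExpansion [Fintype ι] {K : AbstractSimplicialComplex ι}
    {V : Set (Finset ι × Finset ι)} (hV : IsDiscreteGradient K V)
    {A B : PreAbstractSimplicialComplex ι} (hAB : A ≤ B) (hne : A ≠ B)
    (hBK : ∀ σ ∈ B, σ ∈ K) (hA : ∀ p ∈ V, p.1 ∈ A ↔ p.2 ∈ A) (hB : ∀ p ∈ V, p.1 ∈ B ↔ p.2 ∈ B)
    (hcrit : ∀ σ ∈ B, IsCritical K V σ → σ ∈ A) :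
    ∃ p ∈ V, ∃ B', IsElementaryExpansion B' B p.1 p.2 ∧ p.1 ∉ A ∧ p.2 ∉ A := by
  have hpair : ∀ σ ∈ B, σ ∉ A → ∃ p ∈ V, σ = p.1 ∨ σ = p.2 := by
    intro σ h1 h2
    by_contra! h
    exact h2 (hcrit σ h1 ⟨hBK σ h1, h⟩)
  obtain ⟨τ₀, ⟨hτB, hτA⟩, hmax⟩ := Set.exists_max_image {σ | σ ∈ B ∧ σ ∉ A} Finset.card
    (Set.toFinite _) (by
      by_contra! h
      refine hne (le_antisymm hAB fun σ hσ => ?_)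
      by_contra h'
      exact h.le (show σ ∈ {σ | σ ∈ B ∧ σ ∉ A} from ⟨hσ, h'⟩))
  -- A simplex of maximal dimension outside `A` is the upper one of its pair, as otherwise its
  -- partner would be larger and still outside `A`.
  have htop : ∀ ρ ∈ B, ρ ∉ A → ρ.card = τ₀.card → ∃ p ∈ V, ρ = p.2 := by
    intro ρ h1 h2 h3
    obtain ⟨p, hp, h | h⟩ := hpair ρ h1 h2
    · have h4 := hmax p.2 ⟨(hB p hp).1 (h ▸ h1), fun h' => h2 (h ▸ (hA p hp).2 h')⟩
      have h5 := (hV.isFacet p hp).2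
      rw [← h] at h5
      omega
    · exact ⟨p, hp, h⟩
  obtain ⟨p, ⟨⟨hpV, hpB, hpA, hpc⟩, hp⟩⟩ := hV.exists_isFacet_imp_eq
    (W := {p | p ∈ V ∧ p.2 ∈ B ∧ p.2 ∉ A ∧ p.2.card = τ₀.card}) (fun p hp => hp.1) (by
      obtain ⟨p, hp, h⟩ := htop τ₀ hτB hτA rfl
      exact ⟨p, hp, h ▸ hτB, h ▸ hτA, h ▸ rfl⟩)
  have hp1A : p.1 ∉ A := fun h => hpA ((hA p hpV).1 h)
  have hfac := hV.isFacet p hpV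
  have hp1B := (hB p hpV).2 hpB
  have hnotA : ∀ ρ, p.1 ⊆ ρ → ρ ∉ A := fun ρ h h' =>
    hp1A (mem_of_subset h' h (nonempty_of_mem hp1B))
  -- A coface of `p.1` of codimension one is outside `A` and has top dimension, so it is the upper
  -- simplex of a pair; the choice of `p` by acyclicity makes this pair `p`.
  have hfree : ∀ ρ ∈ B, IsFacet p.1 ρ → ρ = p.2 := by
    intro ρ h1 h2
    have h3 := hnotA ρ h2.1
    have h4 : ρ.card = τ₀.card := by rw [← h2.2, hfac.2, hpc]
    obtain ⟨q, hq, rfl⟩ := htop ρ h1 h3 h4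
    rw [hp q ⟨hq, h1, h3, h4⟩ h2]
  refine ⟨p, hpV, ⟨{ρ | ρ ∈ B ∧ ρ ≠ p.1 ∧ ρ ≠ p.2}, ?_⟩,
    ⟨hfac, hp1B, hpB, fun ρ => Iff.rfl, hfree⟩, hp1A, hpA⟩
  rintro ρ ⟨h1, h2, h3⟩
  refine ⟨nonempty_of_mem h1, fun ρ' hsub hρ' => ⟨mem_of_subset h1 hsub hρ', ?_, ?_⟩⟩
  · rintro rfl
    refine h3 (hfree ρ h1 ⟨hsub, ?_⟩)
    have h4 := hmax ρ ⟨h1, hnotA ρ hsub⟩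
    have h5 := Finset.card_lt_card (Finset.ssubset_iff_subset_ne.2 ⟨hsub, Ne.symm h2⟩)
    have := hfac.2
    omega
  · rintro rfl
    have h4 := hmax ρ ⟨h1, hnotA ρ (hfac.1.trans hsub)⟩
    have h5 := Finset.card_lt_card (Finset.ssubset_iff_subset_ne.2 ⟨hsub, Ne.symm h3⟩)
    omega

variable {𝕜 : Type*} [Field 𝕜] [Fintype ι] [LinearOrder ι]

theorem homologyMap_refl (A : PreAbstractSimplicialComplex ι) (p : ℤ) :
    homologyMap 𝕜 (le_refl A) p = LinearMap.id :=
  (homologyModule 𝕜 p).map_refl A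

theorem homologyMap_comp {A B C : PreAbstractSimplicialComplex ι} (h : A ≤ B) (h' : B ≤ C)
    (p : ℤ) : homologyMap 𝕜 h' p ∘ₗ homologyMap 𝕜 h p = homologyMap 𝕜 (h.trans h') p :=
  (homologyModule 𝕜 p).map_trans h h'

theorem homologyMap_mk {A B : PreAbstractSimplicialComplex ι} (h : A ≤ B) (p : ℤ)
    (z : cycles 𝕜 A p) :
    homologyMap 𝕜 h p (Submodule.Quotient.mk z) =
      Submodule.Quotient.mk (Submodule.inclusion (cycles_mono 𝕜 h p) z) :=
  rfl

namespace IsElementaryExpansion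

variable {B' B : PreAbstractSimplicialComplex ι} {σ τ : Finset ι}

/-- The chain `c` made free of `σ` by adding a multiple of the boundary of `τ`. -/
def retract (𝕜 : Type*) [Field 𝕜] (σ τ : Finset ι) (c : Finset ι → 𝕜) : Finset ι → 𝕜 :=
  c - (c σ / boundary 𝕜 (Pi.single τ 1) σ) • boundary 𝕜 (Pi.single τ 1)

theorem boundary_retract (c : Finset ι → 𝕜) :
    boundary 𝕜 (retract 𝕜 σ τ c) = boundary 𝕜 c := by
  rw [retract, map_sub, map_smul, boundary_boundary_single, smul_zero, sub_zero]

/-- Among the simplices of `B`, only `τ` has `σ` as a facet, so the coefficient of the boundary of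
`c` at `σ` is a nonzero multiple of `c τ`; its vanishing gives `c τ = 0`. The retraction then
cancels `σ` and does not bring in `τ`. -/
theorem retract_mem_chains (h : IsElementaryExpansion B' B σ τ) {p : ℤ} {c : Finset ι → 𝕜}
    (hc : c ∈ chains 𝕜 B p) (h0 : boundary 𝕜 c σ = 0) : retract 𝕜 σ τ c ∈ chains 𝕜 B' p := by
  have hne := boundary_single_ne_zero (𝕜 := 𝕜) h.isFacet (nonempty_of_mem h.left_mem)
  have hτ : c τ = 0 := by
    rw [boundary_apply, Finset.sum_eq_single τ] at h0
    · exact (mul_eq_zero.1 h0).resolve_right hne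
    · intro ρ _ hρ
      by_contra h'
      exact hρ (h.eq_of_isFacet ρ (hc ρ (left_ne_zero_of_mul h')).1
        (isFacet_of_boundary_single_ne_zero (right_ne_zero_of_mul h')).1)
    · exact fun h' => absurd (Finset.mem_univ _) h'
  intro ρ hρ
  have hρσ : ρ ≠ σ := by
    rintro rfl
    refine hρ ?_
    simp [retract, hne]
  have hρτ : ρ ≠ τ := by
    rintro rfl
    refine hρ ?_
    have : boundary 𝕜 (Pi.single ρ 1) ρ = 0 := by
      by_contra h'
      have := (isFacet_of_boundary_single_ne_zero h').1.2
      omega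
    simp [retract, hτ, this]
  rw [h.mem_iff]
  by_cases hcρ : c ρ = 0
  · have h1 : c σ / boundary 𝕜 (Pi.single τ 1) σ * boundary 𝕜 (Pi.single τ 1) ρ ≠ 0 := by
      simpa [retract, hcρ] using hρ
    obtain ⟨h2, h3⟩ := isFacet_of_boundary_single_ne_zero (right_ne_zero_of_mul h1)
    have h4 : c σ ≠ 0 := fun h4 => h1 (by simp [h4])
    refine ⟨⟨mem_of_subset h.right_mem h2.1 h3, hρσ, hρτ⟩, ?_⟩
    rw [← (hc σ h4).2]
    have := h2.2
    have := h.isFacet.2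
    omega
  · exact ⟨⟨(hc ρ hcρ).1, hρσ, hρτ⟩, (hc ρ hcρ).2⟩

/-- The retraction keeps boundaries. For injectivity, it moves a chain of `B` that bounds a cycle of
`B'` into `B'`; for surjectivity, it moves a cycle of `B` into `B'`, changing it by a multiple of
the boundary of `τ`. -/
theorem bijective_homologyMap (h : IsElementaryExpansion B' B σ τ) (p : ℤ) :
    Function.Bijective (homologyMap 𝕜 h.le p) := by
  constructor
  · rw [← LinearMap.ker_eq_bot, LinearMap.ker_eq_bot']
    intro x hx
    obtain ⟨z, rfl⟩ := Submodule.mkQ_surjective _ x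
    rw [Submodule.mkQ_apply, homologyMap_mk, Submodule.Quotient.mk_eq_zero] at hx
    rw [Submodule.mkQ_apply, Submodule.Quotient.mk_eq_zero]
    obtain ⟨c, hc, hcz⟩ := hx
    replace hcz : boundary 𝕜 c = z.1 := hcz
    refine ⟨retract 𝕜 σ τ c, h.retract_mem_chains hc ?_, (boundary_retract c).trans hcz⟩
    rw [hcz]
    by_contra h'
    exact ((h.mem_iff _).1 (z.2.1 σ h').1).2.1 rfl
  · intro x
    obtain ⟨z, rfl⟩ := Submodule.mkQ_surjective _ x
    have hz : boundary 𝕜 z.1 = 0 := z.2.2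
    have hz' : retract 𝕜 σ τ z.1 ∈ cycles 𝕜 B' p :=
      ⟨h.retract_mem_chains z.2.1 (by rw [hz]; rfl), (boundary_retract _).trans hz⟩
    refine ⟨Submodule.mkQ _ ⟨_, hz'⟩, ?_⟩
    rw [Submodule.mkQ_apply, homologyMap_mk, Submodule.mkQ_apply, eq_comm, Submodule.Quotient.eq]
    change z.1 - retract 𝕜 σ τ z.1 ∈ boundaries 𝕜 B p
    rw [retract, sub_sub_cancel]
    -- Only when `σ` occurs in `z` is the dimension of `τ` known to be `p + 1`; otherwise the
    -- correction is zero.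
    by_cases h0 : z.1 σ = 0
    · rw [h0, zero_div, zero_smul]
      exact zero_mem _
    · refine Submodule.smul_mem _ _ ⟨Pi.single τ 1, fun ρ hρ => ?_, rfl⟩
      have : ρ = τ := by
        by_contra h'
        simp [h'] at hρ
      subst this
      have h1 := (z.2.1 σ h0).2
      have := h.isFacet.2
      exact ⟨h.right_mem, by omega⟩

end IsElementaryExpansion

/-! ### Homology and collapses -/

/-- If the simplices of `B` that are not in `A` are a union of pairs of a gradient vector field, then
the inclusion of `A` in `B` induces isomorphisms in homology. -/
theorem IsDiscreteGradient.bijective_homologyMap {K : AbstractSimplicialComplex ι}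
    {V : Set (Finset ι × Finset ι)} (hV : IsDiscreteGradient K V)
    {A B : PreAbstractSimplicialComplex ι} (hAB : A ≤ B)
    (hBK : ∀ σ ∈ B, σ ∈ K) (hA : ∀ p ∈ V, p.1 ∈ A ↔ p.2 ∈ A) (hB : ∀ p ∈ V, p.1 ∈ B ↔ p.2 ∈ B)
    (hcrit : ∀ σ ∈ B, IsCritical K V σ → σ ∈ A) (p : ℤ) :
    Function.Bijective (homologyMap 𝕜 hAB p) := by
  -- `A` stays fixed while collapses shrink `B` towards it.
  induction hm : {σ | σ ∈ B}.ncard using Nat.strong_induction_on generalizing B with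
  | h m ih =>
  by_cases hne : A = B
  · subst hne
    rw [homologyMap_refl]
    exact Function.bijective_id
  obtain ⟨q, hq, B', hB', hq1, hq2⟩ := hV.exists_isElementaryExpansion hAB hne hBK hA hB hcrit
  have hAB' : A ≤ B' := fun σ hσ => (hB'.mem_iff σ).2
    ⟨hAB hσ, fun h => hq1 (h ▸ hσ), fun h => hq2 (h ▸ hσ)⟩
  have h1 := ih {σ | σ ∈ B'}.ncard (by
      rw [← hm]
      refine Set.ncard_lt_ncard ⟨fun σ hσ => hB'.le hσ, fun h => ?_⟩ (Set.toFinite _)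
      exact ((hB'.mem_iff _).1 (h hB'.left_mem)).2.1 rfl) hAB' (fun σ hσ => hBK σ (hB'.le hσ))
    -- Pairs are disjoint, so removing the pair `q` splits no other pair.
    (fun r hr => by
      rw [hB'.mem_iff, hB'.mem_iff, hB r hr]
      refine and_congr_right fun _ => ?_
      have h1 := hV.unique r hr q hq r.1 (.inl rfl)
      have h2 := hV.unique r hr q hq r.2 (.inr rfl)
      constructor
      · rintro ⟨h3, h4⟩
        exact ⟨fun h => h3 (by rw [h2 (.inl h)]), fun h => h3 (by rw [h2 (.inr h)])⟩
      · rintro ⟨h3, h4⟩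
        exact ⟨fun h => h4 (by rw [h1 (.inl h)]), fun h => h4 (by rw [h1 (.inr h)])⟩)
    (fun σ hσ => hcrit σ (hB'.le hσ)) rfl
  rw [← homologyMap_comp hAB' hB'.le, LinearMap.coe_comp]
  exact Function.Bijective.comp (hB'.bijective_homologyMap p) h1

end Collapse

open Filter Topology

/-! ### Rank inequalities -/

section Rank

variable {𝕜 : Type*} [Field 𝕜]

theorem finrank_map_add_finrank_inf_ker {E E' : Type*} [AddCommGroup E] [Module 𝕜 E]
    [FiniteDimensional 𝕜 E] [AddCommGroup E'] [Module 𝕜 E'] (g : E →ₗ[𝕜] E')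
    (p : Submodule 𝕜 E) :
    Module.finrank 𝕜 (p.map g) + Module.finrank 𝕜 ↥(p ⊓ LinearMap.ker g) =
      Module.finrank 𝕜 p := by
  rw [← LinearMap.range_domRestrict, ← LinearMap.finrank_range_add_finrank_ker (g.domRestrict p),
    LinearMap.ker_domRestrict, ← Submodule.map_comap_subtype, Submodule.finrank_map_subtype_eq]

variable {P : Type*} [Preorder P] (M : PersistenceModule 𝕜 P)

theorem PersistenceModule.range_map_trans {a b c : P} (h : a ≤ b) (h' : b ≤ c) :
    LinearMap.range (M.map (h.trans h')) = (LinearMap.range (M.map h)).map (M.map h') := by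
  rw [← M.map_trans h h', LinearMap.range_comp]

theorem PersistenceModule.range_map_le {a b c : P} (h : a ≤ b) (h' : b ≤ c) :
    LinearMap.range (M.map (h.trans h')) ≤ LinearMap.range (M.map h') := by
  rw [← M.map_trans h h']
  exact LinearMap.range_comp_le_range _ _

/-- The rank does not change along isomorphisms. -/
theorem rankInv_eq_of_bijective {a a' b b' : P} (hab : a ≤ b) (hab' : a' ≤ b') (ha : a ≤ a')
    (hb : b ≤ b') (ha' : Function.Surjective (M.map ha)) (hb' : Function.Injective (M.map hb)) :
    rankInv M a b hab = rankInv M a' b' hab' := by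
  have h1 : LinearMap.range (M.map hab') = (LinearMap.range (M.map hab)).map (M.map hb) := by
    rw [← M.range_map_trans hab hb, M.range_map_trans ha hab', LinearMap.range_eq_top.2 ha',
      Submodule.map_top]
  rw [rankInv, rankInv, h1,
    LinearEquiv.finrank_eq (Submodule.equivMapOfInjective (M.map hb) hb' _)]

open Classical in
/-- The rank of the transition map from `a` to `b`, and zero if `a ≤ b` does not hold. -/
def rank (a b : P) : ℤ :=
  if h : a ≤ b then rankInv M a b h else 0

variable {M} in
theorem rank_of_le {a b : P} (h : a ≤ b) : rank M a b = rankInv M a b h :=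
  dif_pos h

/-- The alternating sum of ranks that counts the intervals born between `a` and `b` that die between
`c` and `d`. -/
def boxRank (a b c d : P) : ℤ :=
  rank M b c - rank M a c - rank M b d + rank M a d

variable [∀ u, FiniteDimensional 𝕜 (M.space u)]

theorem rank_le_rank {a b c : P} (hab : a ≤ b) (hbc : b ≤ c) : rank M a c ≤ rank M b c := by
  rw [rank_of_le (hab.trans hbc), rank_of_le hbc, rankInv, rankInv, Int.ofNat_le]
  exact Submodule.finrank_mono (M.range_map_le hab hbc)

/-- The difference of the ranks from `b` to `c` and to `d` is the dimension of the part of the image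
in `c` that dies in `d`. The corresponding part of the image from `a` is a subspace of it. -/
theorem boxRank_nonneg {a b c d : P} (hab : a ≤ b) (hbc : b ≤ c) (hcd : c ≤ d) :
    0 ≤ boxRank M a b c d := by
  rw [boxRank, rank_of_le hbc, rank_of_le (hab.trans hbc), rank_of_le (hbc.trans hcd),
    rank_of_le ((hab.trans hbc).trans hcd)]
  simp only [rankInv]
  have h1 := finrank_map_add_finrank_inf_ker (M.map hcd) (LinearMap.range (M.map hbc))
  have h2 := finrank_map_add_finrank_inf_ker (M.map hcd)
    (LinearMap.range (M.map (hab.trans hbc)))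
  have h3 := Submodule.finrank_mono
    (inf_le_inf_right (LinearMap.ker (M.map hcd)) (M.range_map_le hab hbc))
  rw [← M.range_map_trans] at h1 h2
  omega

/-- `boxRank` is additive under subdivision of either interval, so the difference of the two sides
is a sum of four nonnegative box ranks. -/
theorem boxRank_anti {a a' b' b c c' d' d : P} (ha : a ≤ a') (hab : a' ≤ b') (hb : b' ≤ b)
    (hbc : b ≤ c) (hc : c ≤ c') (hcd : c' ≤ d') (hd : d' ≤ d) :
    boxRank M a' b' c' d' ≤ boxRank M a b c d := by
  have h1 := boxRank_nonneg M ha (hab.trans (hb.trans hbc)) (hc.trans (hcd.trans hd))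
  have h2 := boxRank_nonneg M hb hbc (hc.trans (hcd.trans hd))
  have h3 := boxRank_nonneg M hab (hb.trans hbc) hc
  have h4 := boxRank_nonneg M hab (hb.trans (hbc.trans (hc.trans hcd))) hd
  simp only [boxRank] at *
  linarith

theorem rank_sub_rank_anti {a a' b' b v v' : P} (ha : a ≤ a') (hab : a' ≤ b') (hb : b' ≤ b)
    (hbv : b ≤ v) (hv : v ≤ v') :
    rank M b' v' - rank M a' v' ≤ rank M b v - rank M a v := by
  have h1 := boxRank_nonneg M (ha.trans (hab.trans hb)) hbv hv
  have h2 := rank_le_rank M ha (hab.trans (hb.trans (hbv.trans hv)))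
  have h3 := rank_le_rank M hb (hbv.trans hv)
  simp only [boxRank] at *
  linarith

end Rank

/-! ### Multiplicities as limits -/

section Multiplicity

variable {𝕜 : Type*} [Field 𝕜] (M : PersistenceModule 𝕜 ℝ)
  [∀ u, FiniteDimensional 𝕜 (M.space u)]

theorem eventually_pos_lt {r : ℝ} (hr : 0 < r) : ∀ᶠ e : ℝ in 𝓝[>] 0, 0 < e ∧ e < r :=
  Ioo_mem_nhdsGT hr

/-- The alternating sums decrease as `e` shrinks, so the eventual value is attained and is a lower
bound for all the others. The integer infimum is thus a genuine minimum. -/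
theorem multFinite_eq_of_eventually {s t : ℝ} (hst : s < t) {k : ℤ}
    (h : ∀ᶠ e in 𝓝[>] (0 : ℝ), boxRank M (s - e) (s + e) (t - e) (t + e) = k) :
    multFinite M s t = k := by
  refine IsLeast.csInf_eq ⟨?_, ?_⟩
  · obtain ⟨e, he, he0, he1⟩ := (h.and (eventually_pos_lt (half_pos (sub_pos.2 hst)))).exists
    refine ⟨e, he0, by linarith, ?_⟩
    rw [← rank_of_le, ← rank_of_le, ← rank_of_le, ← rank_of_le]
    exact he.symm
  · rintro _ ⟨e, he, hlt, rfl⟩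
    obtain ⟨e', he', h0, h1⟩ := (h.and (eventually_pos_lt he)).exists
    rw [← rank_of_le, ← rank_of_le, ← rank_of_le, ← rank_of_le, ← he']
    refine boxRank_anti M ?_ ?_ ?_ ?_ ?_ ?_ ?_ <;> linarith

theorem multInfinite_eq_of_eventually {s : ℝ} {k : ℤ}
    (h : ∀ᶠ e in 𝓝[>] (0 : ℝ), ∀ᶠ v in atTop, rank M (s + e) v - rank M (s - e) v = k) :
    multInfinite M s = k := by
  refine IsLeast.csInf_eq ⟨?_, ?_⟩
  · obtain ⟨e, he, he0, -⟩ := (h.and (eventually_pos_lt one_pos)).exists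
    obtain ⟨v, hv, hev⟩ := (he.and (eventually_ge_atTop (s + e))).exists
    refine ⟨e, v, he0, hev, ?_⟩
    rw [← rank_of_le, ← rank_of_le]
    exact hv.symm
  · rintro _ ⟨e, v, he, hev, rfl⟩
    obtain ⟨e', he', h0, h1⟩ := (h.and (eventually_pos_lt he)).exists
    obtain ⟨v', hv', hev'⟩ := (he'.and (eventually_ge_atTop v)).exists
    rw [← rank_of_le, ← rank_of_le, ← hv']
    refine rank_sub_rank_anti M ?_ ?_ ?_ ?_ ?_ <;> linarith

/-- No value of `g` on `C` is closer to `s` than `e`, except for `s` itself. -/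
def IsIsolating {α : Type*} (C : Set α) (g : α → ℝ) (s e : ℝ) : Prop :=
  0 < e ∧ ∀ c ∈ C, (g c ≤ s - e ↔ g c < s) ∧ (g c ≤ s + e ↔ g c ≤ s)

theorem eventually_isIsolating {α : Type*} {C : Set α} (hC : C.Finite) (g : α → ℝ) (s : ℝ) :
    ∀ᶠ e in 𝓝[>] (0 : ℝ), IsIsolating C g s e := by
  refine Eventually.and eventually_mem_nhdsWithin ((eventually_all_finite hC).2 fun c _ => ?_)
  rcases lt_trichotomy (g c) s with h | h | h
  · filter_upwards [eventually_pos_lt (sub_pos.2 h)] with e ⟨h0, h1⟩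
    constructor <;> constructor <;> intro <;> linarith
  · filter_upwards [eventually_pos_lt one_pos] with e ⟨h0, h1⟩
    constructor <;> constructor <;> intro <;> linarith
  · filter_upwards [eventually_pos_lt (sub_pos.2 h)] with e ⟨h0, h1⟩
    constructor <;> constructor <;> intro <;> linarith

end Multiplicity

/-! ### Ranks of persistent homology -/

section Filtration

variable {𝕜 : Type*} [Field 𝕜] {ι : Type*} {n : ℕ}
  {K : AbstractSimplicialComplex ι} {F : Filtration K n} {V : Set (Finset ι × Finset ι)}

theorem Filtration.IsEntranceValue.mem_iff (hF : F.IsTameOneCritical) {σ : Finset ι} (hσ : σ ∈ K)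
    {u : Fin n → ℝ} (hu : F.IsEntranceValue σ u) (v : Fin n → ℝ) : σ ∈ F.sub v ↔ u ≤ v := by
  refine ⟨fun h => ?_, fun h => F.sub.monotone h hu.1⟩
  obtain ⟨w, hw, hmin⟩ := hF σ hσ
  have : w = u := by
    by_contra h'
    exact hu.2 w (hmin u hu.1) h' hw.1
  exact this ▸ hmin v h

theorem Filtration.finite_criticalValues [Finite ι] (hF : F.IsTameOneCritical) :
    (F.criticalValues V).Finite := by
  have h : F.criticalValues V ⊆ ⋃ σ : Finset ι, {u | σ ∈ K ∧ F.IsEntranceValue σ u} := by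
    rintro u ⟨σ, h1, h2⟩
    exact Set.mem_iUnion.2 ⟨σ, h1.1, h2⟩
  refine (Set.finite_iUnion fun σ => Set.Subsingleton.finite ?_).subset h
  rintro u ⟨h1, hu⟩ v ⟨-, hv⟩
  exact le_antisymm ((hu.mem_iff hF h1 v).1 hv.1) ((hv.mem_iff hF h1 u).1 hu.1)

theorem Filtration.mem_of_critical_of_le (hF : F.IsTameOneCritical) {σ : Finset ι}
    (hσ : IsCritical K V σ) {u v : Fin n → ℝ} (huv : ∀ c ∈ F.criticalValues V, c ≤ u → c ≤ v)
    (h : σ ∈ F.sub u) : σ ∈ F.sub v := by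
  obtain ⟨w, hw, hmin⟩ := hF σ hσ.1
  exact (hw.mem_iff hF hσ.1 v).2 (huv w ⟨σ, hσ, hw⟩ (hmin u h))

variable [Fintype ι] [LinearOrder ι]

instance (i : ℤ) (u : Fin n → ℝ) :
    FiniteDimensional 𝕜 ((F.persistentHomology 𝕜 i).space u) :=
  inferInstanceAs (FiniteDimensional 𝕜 (Homology 𝕜 (F.sub u) i))

instance (i : ℤ) (L : PositiveLine n) (s : ℝ) :
    FiniteDimensional 𝕜 ((L.restrict (F.persistentHomology 𝕜 i)).space s) :=
  inferInstanceAs (FiniteDimensional 𝕜 (Homology 𝕜 (F.sub (L.point s)) i))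

/-- If the same critical simplices are present at `u` and `v`, then the persistent homology is the
same. -/
theorem IsDiscreteGradient.bijective_persistentHomology_map (hV : IsDiscreteGradient K V)
    (hF : F.IsTameOneCritical) (hFV : F.IsConsistent V) (i : ℤ) {u v : Fin n → ℝ} (h : u ≤ v)
    (huv : ∀ c ∈ F.criticalValues V, c ≤ v → c ≤ u) :
    Function.Bijective ((F.persistentHomology 𝕜 i).map h) :=
  hV.bijective_homologyMap (F.sub.monotone h) (fun σ hσ => (F.mem_iff σ).2 ⟨v, hσ⟩)
    (fun p hp => hFV p hp u) (fun p hp => hFV p hp v)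
    (fun _ hσ hc => F.mem_of_critical_of_le hF hc huv hσ) i

/-- The parameters `u` and `u'` need not be comparable, but `u ⊓ u'` has the same critical values
below it as each of them. Both ranks are compared with the one between the meets. -/
theorem IsDiscreteGradient.rankInv_persistentHomology_eq (hV : IsDiscreteGradient K V)
    (hF : F.IsTameOneCritical) (hFV : F.IsConsistent V) (i : ℤ) {u v u' v' : Fin n → ℝ}
    (h : u ≤ v) (h' : u' ≤ v') (hu : ∀ c ∈ F.criticalValues V, c ≤ u ↔ c ≤ u')
    (hv : ∀ c ∈ F.criticalValues V, c ≤ v ↔ c ≤ v') :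
    rankInv (F.persistentHomology 𝕜 i) u v h = rankInv (F.persistentHomology 𝕜 i) u' v' h' := by
  have key {w w' : Fin n → ℝ} (h : w ⊓ w' ≤ w)
      (hw : ∀ c ∈ F.criticalValues V, c ≤ w ↔ c ≤ w') :
      Function.Bijective ((F.persistentHomology 𝕜 i).map h) :=
    hV.bijective_persistentHomology_map hF hFV i h fun c hc h1 => le_inf h1 ((hw c hc).1 h1)
  have key' {w w' : Fin n → ℝ} (h : w ⊓ w' ≤ w')
      (hw : ∀ c ∈ F.criticalValues V, c ≤ w ↔ c ≤ w') :
      Function.Bijective ((F.persistentHomology 𝕜 i).map h) :=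
    hV.bijective_persistentHomology_map hF hFV i h fun c hc h1 => le_inf ((hw c hc).2 h1) h1
  rw [← rankInv_eq_of_bijective _ (inf_le_inf h h') h inf_le_left inf_le_left
      (key _ hu).2 (key _ hv).1,
    ← rankInv_eq_of_bijective _ (inf_le_inf h h') h' inf_le_right inf_le_right
      (key' _ hu).2 (key' _ hv).1]

end Filtration

/-! ### Pushes to lines of positive slope -/

namespace PositiveLine

variable {n : ℕ}

theorem point_lt_point (L : PositiveLine n) {s t : ℝ} (h : s < t) (i : Fin n) :
    L.point s i < L.point t i := by
  simp only [point, Pi.add_apply, Pi.smul_apply, smul_eq_mul]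
  have := mul_lt_mul_of_pos_right h (L.dir_pos i)
  linarith

variable [NeZero n] (L : PositiveLine n)

theorem push_mem (u : Fin n → ℝ) : L.push u ∈ Set.range L.point ∩ frontier (Set.Ici u) :=
  (L.existsUnique_push u).choose_spec.1

/-- The parameter of the push of a point along a line. -/
def param (u : Fin n → ℝ) : ℝ :=
  (L.push_mem u).1.choose

theorem point_param (u : Fin n → ℝ) : L.point (L.param u) = L.push u :=
  (L.push_mem u).1.choose_spec

theorem le_push (u : Fin n → ℝ) : u ≤ L.push u :=
  (mem_frontier_Ici.1 (L.push_mem u).2).1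

theorem exists_push_apply_eq (u : Fin n → ℝ) : ∃ i, L.push u i = u i :=
  (mem_frontier_Ici.1 (L.push_mem u).2).2

/-- All coordinates increase strictly along the line, and the push shares a coordinate with `u`, so
no earlier point is above `u`. This Galois connection replaces the geometry of pushes from here on.
-/
theorem le_point_iff {u : Fin n → ℝ} {t : ℝ} : u ≤ L.point t ↔ L.param u ≤ t := by
  constructor
  · intro h
    by_contra! h'
    obtain ⟨i, hi⟩ := L.exists_push_apply_eq u
    have h1 := L.point_lt_point h' i
    rw [point_param, hi] at h1
    exact (h i).not_gt h1
  · intro h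
    refine (L.le_push u).trans ?_
    rw [← point_param]
    exact L.monotone_point h

theorem param_mono {u v : Fin n → ℝ} (h : u ≤ v) : L.param u ≤ L.param v :=
  L.le_point_iff.1 (h.trans (L.le_point_iff.2 le_rfl))

theorem param_sup (u v : Fin n → ℝ) : L.param (u ⊔ v) = L.param u ⊔ L.param v :=
  eq_of_forall_ge_iff fun t => by
    rw [← L.le_point_iff, sup_le_iff, sup_le_iff, L.le_point_iff, L.le_point_iff]

variable {L} {L' : PositiveLine n} {U : Set (Fin n → ℝ)}

theorem SameReciprocalPosition.symm (h : L.SameReciprocalPosition L' U) :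
    L'.SameReciprocalPosition L U := fun u hu =>
  let ⟨A, hA, h1, h2⟩ := h u hu
  ⟨A, hA, h2, h1⟩

/-- On `L`, the points `b ⊔ c` and `c` have the same push. At a coordinate `i` where it touches `c`,
it also touches `b ⊔ c`, so `i ∈ A` and `(b ⊔ c) i = c i`. By hypothesis the push of `b ⊔ c` to `L'`
has this same coordinate `c i`, so it cannot come after the push of `c`. -/
theorem SameReciprocalPosition.param_le_param (h : L.SameReciprocalPosition L' U)
    (hU : SupClosed U) {b c : Fin n → ℝ} (hb : b ∈ U) (hc : c ∈ U)
    (hbc : L.param b ≤ L.param c) : L'.param b ≤ L'.param c := by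
  have hpush : L.push (b ⊔ c) = L.push c := by
    rw [← point_param, ← point_param, param_sup, sup_eq_right.2 hbc]
  obtain ⟨A, -, h1, h2⟩ := h _ (hU hb hc)
  obtain ⟨i, hi⟩ := L.exists_push_apply_eq c
  have hci : c i ≤ (b ⊔ c) i := (le_sup_right : c ≤ b ⊔ c) i
  have hiA : i ∈ A := by
    by_contra hiA
    have := h1.2 i hiA
    rw [hpush, hi] at this
    exact this.not_ge hci
  have h3 := h1.1 i hiA
  have h4 := h2.1 i hiA
  rw [hpush, hi] at h3
  refine (L'.param_mono le_sup_left).trans (b := L'.param (b ⊔ c)) ?_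
  by_contra! hlt
  have h5 := L'.point_lt_point hlt i
  rw [point_param, point_param, h4, ← h3] at h5
  exact (L'.le_push c i).not_gt h5

theorem SameReciprocalPosition.param_le_param_iff (h : L.SameReciprocalPosition L' U)
    (hU : SupClosed U) {b c : Fin n → ℝ} (hb : b ∈ U) (hc : c ∈ U) :
    L.param b ≤ L.param c ↔ L'.param b ≤ L'.param c :=
  ⟨h.param_le_param hU hb hc, h.symm.param_le_param hU hb hc⟩

theorem SameReciprocalPosition.param_lt_param_iff (h : L.SameReciprocalPosition L' U)
    (hU : SupClosed U) {b c : Fin n → ℝ} (hb : b ∈ U) (hc : c ∈ U) :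
    L.param b < L.param c ↔ L'.param b < L'.param c := by
  rw [← not_le, ← not_le, h.param_le_param_iff hU hc hb]

/-- Lines in the same reciprocal position have corresponding parameters of pushes. -/
theorem SameReciprocalPosition.exists_param_eq (h : L.SameReciprocalPosition L' U)
    (hU : SupClosed U) : ∃ φ : ℝ → ℝ, ∀ b ∈ U, φ (L.param b) = L'.param b := by
  classical
  -- The value does not depend on the chosen point, as equal parameters on `L` give equal ones on
  -- `L'`. The default `0` is taken only off the pushes of `U`.
  refine ⟨fun s => if hs : ∃ b ∈ U, L.param b = s then L'.param hs.choose else 0,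
    fun b hb => ?_⟩
  have hs : ∃ b' ∈ U, L.param b' = L.param b := ⟨b, hb, rfl⟩
  obtain ⟨h1, h2⟩ := hs.choose_spec
  simp only [dif_pos hs]
  exact le_antisymm (h.param_le_param hU h1 hb h2.le) (h.param_le_param hU hb h1 h2.ge)

end PositiveLine

/-- A finite nonempty set of points of `U` below `u` has its supremum in `U`, again below `u`. -/
theorem exists_isBar {n : ℕ} {U : Set (Fin n → ℝ)} (hU : SupClosed U) (hfin : U.Finite)
    {u c : Fin n → ℝ} (hc : c ∈ U) (hcu : c ≤ u) : ∃ b, IsBar U u b := by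
  have hfin' : {u' | u' ∈ U ∧ u' ≤ u}.Finite := hfin.subset fun _ h => h.1
  have hne : hfin'.toFinset.Nonempty := ⟨c, hfin'.mem_toFinset.2 ⟨hc, hcu⟩⟩
  refine ⟨hfin'.toFinset.sup' hne id, ⟨hU.finsetSup'_mem hne fun v hv => ?_,
    Finset.sup'_le hne _ fun v hv => ?_⟩, fun v hv => ?_⟩
  · exact (hfin'.mem_toFinset.1 hv).1
  · exact (hfin'.mem_toFinset.1 hv).2
  · exact Finset.le_sup' id (hfin'.mem_toFinset.2 hv)

/-- The bar of the push of `c` has the same push as `c`. -/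
theorem exists_isBar_param_eq {n : ℕ} [NeZero n] {U : Set (Fin n → ℝ)} (hU : SupClosed U)
    (hfin : U.Finite) (L : PositiveLine n) {c : Fin n → ℝ} (hc : c ∈ U) :
    ∃ b ∈ U, IsBar U (L.point (L.param c)) b ∧ L.param b = L.param c := by
  have hcu := L.le_point_iff.2 (le_refl (L.param c))
  obtain ⟨b, hb⟩ := exists_isBar hU hfin hc hcu
  exact ⟨b, hb.1.1, hb, le_antisymm (L.le_point_iff.1 hb.1.2) (L.param_mono (hb.2 ⟨hc, hcu⟩))⟩

/-! ### Persistence diagrams along lines -/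

section Diagram

variable {ι : Type*} {n : ℕ} [NeZero n] {K : AbstractSimplicialComplex ι} {F : Filtration K n}
  {V : Set (Finset ι × Finset ι)}

/-- The parameter `s` on `L` and the parameter `s'` on `L'` are in the same position with respect to
the pushes of the points of `C`. -/
def SamePosition (C : Set (Fin n → ℝ)) (L L' : PositiveLine n) (s s' : ℝ) : Prop :=
  ∀ c ∈ C, (L.param c < s ↔ L'.param c < s') ∧ (L.param c ≤ s ↔ L'.param c ≤ s')

theorem SamePosition.refl {C : Set (Fin n → ℝ)} (L : PositiveLine n) (s : ℝ) :
    SamePosition C L L s s :=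
  fun _ _ => ⟨Iff.rfl, Iff.rfl⟩

theorem samePosition_param {L L' : PositiveLine n}
    (hL : L.SameReciprocalPosition L' (F.closedCriticalValues V)) {b : Fin n → ℝ}
    (hb : b ∈ F.closedCriticalValues V) :
    SamePosition (F.criticalValues V) L L' (L.param b) (L'.param b) := fun _ hc =>
  ⟨hL.param_lt_param_iff supClosed_supClosure (subset_supClosure hc) hb,
    hL.param_le_param_iff supClosed_supClosure (subset_supClosure hc) hb⟩

variable {𝕜 : Type*} [Field 𝕜] [Fintype ι] [LinearOrder ι]

theorem IsDiscreteGradient.rank_restrict_eq (hV : IsDiscreteGradient K V)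
    (hF : F.IsTameOneCritical) (hFV : F.IsConsistent V) (i : ℤ) {L L' : PositiveLine n}
    {s t s' t' : ℝ} (hst : s ≤ t) (hst' : s' ≤ t')
    (hs : ∀ c ∈ F.criticalValues V, L.param c ≤ s ↔ L'.param c ≤ s')
    (ht : ∀ c ∈ F.criticalValues V, L.param c ≤ t ↔ L'.param c ≤ t') :
    rank (L.restrict (F.persistentHomology 𝕜 i)) s t =
      rank (L'.restrict (F.persistentHomology 𝕜 i)) s' t' := by
  rw [rank_of_le hst, rank_of_le hst']
  exact hV.rankInv_persistentHomology_eq hF hFV i (L.monotone_point hst) (L'.monotone_point hst')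
    (fun c hc => by rw [L.le_point_iff, L'.le_point_iff, hs c hc])
    (fun c hc => by rw [L.le_point_iff, L'.le_point_iff, ht c hc])

/-- For small `e`, the critical values with push parameter at most `s - e` or `s + e` are those with
parameter `< s` or `≤ s`, and similarly at `t`. `SamePosition` preserves exactly these comparisons.
-/
theorem IsDiscreteGradient.multFinite_eq (hV : IsDiscreteGradient K V)
    (hF : F.IsTameOneCritical) (hFV : F.IsConsistent V) (i : ℤ) {L L' : PositiveLine n}
    {s t s' t' : ℝ} (hst : s < t) (hst' : s' < t')
    (hs : SamePosition (F.criticalValues V) L L' s s')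
    (ht : SamePosition (F.criticalValues V) L L' t t') :
    multFinite (L.restrict (F.persistentHomology 𝕜 i)) s t =
      multFinite (L'.restrict (F.persistentHomology 𝕜 i)) s' t' := by
  have hC := F.finite_criticalValues (V := V) hF
  have near (L : PositiveLine n) {s t : ℝ} (hst : s < t) :=
    ((eventually_isIsolating hC L.param s).and (eventually_isIsolating hC L.param t)).and
      (eventually_pos_lt (half_pos (sub_pos.2 hst)))
  have key {L₁ L₂ : PositiveLine n} {s₁ t₁ s₂ t₂ e : ℝ}
      (hs1 : IsIsolating (F.criticalValues V) L₁.param s₁ e)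
      (ht1 : IsIsolating (F.criticalValues V) L₁.param t₁ e)
      (he : e < (t₁ - s₁) / 2) (h₂ : s₂ < t₂)
      (hs : SamePosition (F.criticalValues V) L₁ L₂ s₁ s₂)
      (ht : SamePosition (F.criticalValues V) L₁ L₂ t₁ t₂) :
      multFinite (L₂.restrict (F.persistentHomology 𝕜 i)) s₂ t₂ =
        boxRank (L₁.restrict (F.persistentHomology 𝕜 i)) (s₁ - e) (s₁ + e) (t₁ - e) (t₁ + e) := by
    have he0 := hs1.1
    refine multFinite_eq_of_eventually _ h₂ ?_
    filter_upwards [near L₂ h₂] with e' ⟨⟨hs2, ht2⟩, he0', he'⟩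
    have e1 : ∀ c ∈ F.criticalValues V, L₂.param c ≤ s₂ - e' ↔ L₁.param c ≤ s₁ - e :=
      fun c hc => by rw [(hs1.2 c hc).1, (hs2.2 c hc).1, (hs c hc).1]
    have e2 : ∀ c ∈ F.criticalValues V, L₂.param c ≤ s₂ + e' ↔ L₁.param c ≤ s₁ + e :=
      fun c hc => by rw [(hs1.2 c hc).2, (hs2.2 c hc).2, (hs c hc).2]
    have e3 : ∀ c ∈ F.criticalValues V, L₂.param c ≤ t₂ - e' ↔ L₁.param c ≤ t₁ - e :=
      fun c hc => by rw [(ht1.2 c hc).1, (ht2.2 c hc).1, (ht c hc).1]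
    have e4 : ∀ c ∈ F.criticalValues V, L₂.param c ≤ t₂ + e' ↔ L₁.param c ≤ t₁ + e :=
      fun c hc => by rw [(ht1.2 c hc).2, (ht2.2 c hc).2, (ht c hc).2]
    rw [boxRank, boxRank,
      hV.rank_restrict_eq hF hFV i (by linarith) (by linarith) e2 e3,
      hV.rank_restrict_eq hF hFV i (by linarith) (by linarith) e1 e3,
      hV.rank_restrict_eq hF hFV i (by linarith) (by linarith) e2 e4,
      hV.rank_restrict_eq hF hFV i (by linarith) (by linarith) e1 e4]
  obtain ⟨e, ⟨hs1, ht1⟩, -, he⟩ := (near L hst).exists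
  -- Both multiplicities equal the box rank on `L` for the one fixed `e`: `key` is used once with
  -- `L` itself and once with `L'`.
  rw [key hs1 ht1 he hst (.refl _ _) (.refl _ _), key hs1 ht1 he hst' hs ht]

/-- Beyond the pushes of all critical values the module is constant up to isomorphism, so such a `v`
stands for infinity. -/
theorem eventually_forall_param_le {C : Set (Fin n → ℝ)} (hC : C.Finite) (L : PositiveLine n)
    (s : ℝ) : ∀ᶠ v in atTop, (∀ c ∈ C, L.param c ≤ v) ∧ s ≤ v :=
  ((eventually_all_finite hC).2 fun c _ => eventually_ge_atTop (L.param c)).and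
    (eventually_ge_atTop s)

theorem IsDiscreteGradient.multInfinite_eq (hV : IsDiscreteGradient K V)
    (hF : F.IsTameOneCritical) (hFV : F.IsConsistent V) (i : ℤ) {L L' : PositiveLine n}
    {s s' : ℝ} (hs : SamePosition (F.criticalValues V) L L' s s') :
    multInfinite (L.restrict (F.persistentHomology 𝕜 i)) s =
      multInfinite (L'.restrict (F.persistentHomology 𝕜 i)) s' := by
  have hC := F.finite_criticalValues (V := V) hF
  have key {L₁ L₂ : PositiveLine n} {s₁ s₂ e v : ℝ}
      (h₁ : IsIsolating (F.criticalValues V) L₁.param s₁ e)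
      (hv : (∀ c ∈ F.criticalValues V, L₁.param c ≤ v) ∧ s₁ + e ≤ v)
      (hs : SamePosition (F.criticalValues V) L₁ L₂ s₁ s₂) :
      multInfinite (L₂.restrict (F.persistentHomology 𝕜 i)) s₂ =
        rank (L₁.restrict (F.persistentHomology 𝕜 i)) (s₁ + e) v -
          rank (L₁.restrict (F.persistentHomology 𝕜 i)) (s₁ - e) v := by
    refine multInfinite_eq_of_eventually _ ?_
    filter_upwards [eventually_isIsolating hC L₂.param s₂] with e' ⟨he', h₂⟩
    filter_upwards [eventually_forall_param_le hC L₂ (s₂ + e')] with v' ⟨hv1, hv2⟩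
    have he := h₁.1
    have hv3 := hv.2
    have e1 : ∀ c ∈ F.criticalValues V, L₂.param c ≤ s₂ - e' ↔ L₁.param c ≤ s₁ - e :=
      fun c hc => by rw [(h₁.2 c hc).1, (h₂ c hc).1, (hs c hc).1]
    have e2 : ∀ c ∈ F.criticalValues V, L₂.param c ≤ s₂ + e' ↔ L₁.param c ≤ s₁ + e :=
      fun c hc => by rw [(h₁.2 c hc).2, (h₂ c hc).2, (hs c hc).2]
    have e3 : ∀ c ∈ F.criticalValues V, L₂.param c ≤ v' ↔ L₁.param c ≤ v :=
      fun c hc => iff_of_true (hv1 c hc) (hv.1 c hc)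
    rw [hV.rank_restrict_eq hF hFV i hv2 hv3 e2 e3,
      hV.rank_restrict_eq hF hFV i (by linarith) (by linarith) e1 e3]
  obtain ⟨e, he⟩ := (eventually_isIsolating hC L.param s).exists
  obtain ⟨v, hv⟩ := (eventually_forall_param_le hC L (s + e)).exists
  rw [key he hv (.refl _ _), key he hv hs]

/-- The rank is locally constant away from the pushes of the critical values. -/
theorem IsDiscreteGradient.eventually_rank_eq (hV : IsDiscreteGradient K V)
    (hF : F.IsTameOneCritical) (hFV : F.IsConsistent V) (i : ℤ) (L : PositiveLine n) {s : ℝ}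
    (hs : ∀ c ∈ F.criticalValues V, L.param c ≠ s) :
    ∀ᶠ e in 𝓝[>] (0 : ℝ), 0 < e ∧
      (∀ v, s + e ≤ v → rank (L.restrict (F.persistentHomology 𝕜 i)) (s - e) v =
        rank (L.restrict (F.persistentHomology 𝕜 i)) (s + e) v) ∧
      (∀ v, v ≤ s - e → rank (L.restrict (F.persistentHomology 𝕜 i)) v (s - e) =
        rank (L.restrict (F.persistentHomology 𝕜 i)) v (s + e)) := by
  filter_upwards [eventually_isIsolating
    (F.finite_criticalValues (V := V) hF) L.param s] with e ⟨he, h⟩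
  have h' : ∀ c ∈ F.criticalValues V, L.param c ≤ s - e ↔ L.param c ≤ s + e := fun c hc => by
    rw [(h c hc).1, (h c hc).2, le_iff_lt_or_eq, or_iff_left (hs c hc)]
  exact ⟨he, fun v hv => hV.rank_restrict_eq hF hFV i (by linarith) hv h' fun _ _ => Iff.rfl,
    fun v hv => hV.rank_restrict_eq hF hFV i hv (by linarith) (fun _ _ => Iff.rfl) h'⟩

/-- If `s` or `t` is not the parameter of a push of a critical value, then ranks do not change
across it and the alternating sum cancels in pairs. -/
theorem IsDiscreteGradient.exists_param_eq_of_multFinite_ne_zero (hV : IsDiscreteGradient K V)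
    (hF : F.IsTameOneCritical) (hFV : F.IsConsistent V) (i : ℤ) (L : PositiveLine n) {s t : ℝ}
    (hst : s < t) (h : multFinite (L.restrict (F.persistentHomology 𝕜 i)) s t ≠ 0) :
    (∃ c ∈ F.criticalValues V, L.param c = s) ∧ ∃ c ∈ F.criticalValues V, L.param c = t := by
  constructor <;> by_contra! h' <;> refine h (multFinite_eq_of_eventually _ hst ?_) <;>
    filter_upwards [hV.eventually_rank_eq (𝕜 := 𝕜) hF hFV i L h',
      eventually_pos_lt (half_pos (sub_pos.2 hst))] with e ⟨he, h1, h2⟩ ⟨_, h3⟩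
  · rw [boxRank, h1 _ (by linarith), h1 _ (by linarith)]
    ring
  · rw [boxRank, h2 _ (by linarith), h2 _ (by linarith)]
    ring

theorem IsDiscreteGradient.exists_param_eq_of_multInfinite_ne_zero (hV : IsDiscreteGradient K V)
    (hF : F.IsTameOneCritical) (hFV : F.IsConsistent V) (i : ℤ) (L : PositiveLine n) {s : ℝ}
    (h : multInfinite (L.restrict (F.persistentHomology 𝕜 i)) s ≠ 0) :
    ∃ c ∈ F.criticalValues V, L.param c = s := by
  by_contra! h'
  refine h (multInfinite_eq_of_eventually _ ?_)
  filter_upwards [hV.eventually_rank_eq (𝕜 := 𝕜) hF hFV i L h'] with e ⟨he, h1, h2⟩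
  filter_upwards [eventually_ge_atTop (s + e)] with v hv
  rw [h1 v hv, sub_self]

/-- The coordinates of a point of the persistence diagram are infinite or parameters of pushes of
critical values. -/
theorem IsDiscreteGradient.exists_eq_param_of_mem_dgm (hV : IsDiscreteGradient K V)
    (hF : F.IsTameOneCritical) (hFV : F.IsConsistent V) (i : ℤ) (L : PositiveLine n)
    {p : ℝ × WithTop ℝ} (hp : p ∈ dgm (L.restrict (F.persistentHomology 𝕜 i))) :
    ∃ b ∈ F.closedCriticalValues V, p.1 = L.param b ∧
      (p.2 = ⊤ ∨ ∃ c ∈ F.closedCriticalValues V, p.2 = (L.param c : WithTop ℝ)) := by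
  obtain ⟨s, t⟩ := p
  obtain ⟨h1, h2⟩ := hp
  induction t using WithTop.recTopCoe with
  | top =>
    obtain ⟨b, hb, rfl⟩ := hV.exists_param_eq_of_multInfinite_ne_zero hF hFV i L h2.ne'
    exact ⟨b, subset_supClosure hb, rfl, .inl rfl⟩
  | coe t =>
    obtain ⟨⟨b, hb, rfl⟩, c, hc, rfl⟩ := hV.exists_param_eq_of_multFinite_ne_zero hF hFV i L
      (WithTop.coe_lt_coe.1 h1) h2.ne'
    exact ⟨b, subset_supClosure hb, rfl, .inr ⟨c, subset_supClosure hc, rfl⟩⟩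

/-- The correspondence of parameters of pushes maps the persistence diagram along a line to the one
along a line in the same reciprocal position. -/
theorem IsDiscreteGradient.map_mem_dgm (hV : IsDiscreteGradient K V)
    (hF : F.IsTameOneCritical) (hFV : F.IsConsistent V) (i : ℤ) {L L' : PositiveLine n}
    (hL : L.SameReciprocalPosition L' (F.closedCriticalValues V)) {φ : ℝ → ℝ}
    (hφ : ∀ b ∈ F.closedCriticalValues V, φ (L.param b) = L'.param b) {p : ℝ × WithTop ℝ}
    (hp : p ∈ dgm (L.restrict (F.persistentHomology 𝕜 i))) :
    (φ p.1, p.2.map φ) ∈ dgm (L'.restrict (F.persistentHomology 𝕜 i)) ∧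
      mult (L'.restrict (F.persistentHomology 𝕜 i)) (φ p.1, p.2.map φ) =
        mult (L.restrict (F.persistentHomology 𝕜 i)) p := by
  obtain ⟨b, hb, h1, h2⟩ := hV.exists_eq_param_of_mem_dgm hF hFV i L hp
  obtain ⟨s, t⟩ := p
  obtain ⟨hst, hpos⟩ := hp
  simp only at h1 h2 hst
  subst h1
  have hs := samePosition_param hL hb
  rw [← hφ b hb] at hs
  suffices h : ((φ (L.param b) : ℝ) : WithTop ℝ) < t.map φ ∧
      mult (L'.restrict (F.persistentHomology 𝕜 i)) (φ (L.param b), t.map φ) =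
        mult (L.restrict (F.persistentHomology 𝕜 i)) (L.param b, t) from
    ⟨⟨h.1, h.2.symm ▸ hpos⟩, h.2⟩
  rcases h2 with rfl | ⟨c, hc, rfl⟩
  · exact ⟨WithTop.coe_lt_top _, (hV.multInfinite_eq hF hFV i hs).symm⟩
  · have ht := samePosition_param hL hc
    have hlt := WithTop.coe_lt_coe.1 hst
    have hlt' := (hL.param_lt_param_iff supClosed_supClosure hb hc).1 hlt
    rw [← hφ b hb, ← hφ c hc] at hlt'
    rw [← hφ c hc] at ht
    exact ⟨WithTop.coe_lt_coe.2 hlt', (hV.multFinite_eq hF hFV i hlt hlt' hs ht).symm⟩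

/-- The maps `φ` and `ψ` are inverse only on push parameters, which suffices because all finite
coordinates of diagram points are of this kind. -/
theorem IsDiscreteGradient.map_map_eq (hV : IsDiscreteGradient K V)
    (hF : F.IsTameOneCritical) (hFV : F.IsConsistent V) (i : ℤ) {L L' : PositiveLine n}
    {φ ψ : ℝ → ℝ} (hφ : ∀ b ∈ F.closedCriticalValues V, φ (L.param b) = L'.param b)
    (hψ : ∀ b ∈ F.closedCriticalValues V, ψ (L'.param b) = L.param b) {p : ℝ × WithTop ℝ}
    (hp : p ∈ dgm (L.restrict (F.persistentHomology 𝕜 i))) :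
    (ψ (φ p.1), (p.2.map φ).map ψ) = p := by
  obtain ⟨b, hb, h1, h2⟩ := hV.exists_eq_param_of_mem_dgm hF hFV i L hp
  obtain ⟨s, t⟩ := p
  simp only at h1 h2
  subst h1
  rcases h2 with rfl | ⟨c, hc, rfl⟩
  · simp [hφ b hb, hψ b hb]
  · simp [hφ b hb, hψ b hb, hφ c hc, hψ c hc]

end Diagram

end MorsePersistence

end

/-! ### The bijection of persistence diagrams -/

theorem theorem3p11 {𝕜 : Type*} [Field 𝕜] {ι : Type*} [Fintype ι] [LinearOrder ι]
    {n : ℕ} [NeZero n] (K : AbstractSimplicialComplex ι)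
    (F : MorsePersistence.Filtration K n) (hF : F.IsTameOneCritical)
    (V : Set (Finset ι × Finset ι)) (hV : MorsePersistence.IsDiscreteGradient K V)
    (hFV : F.IsConsistent V) (i : ℤ) (L L' : MorsePersistence.PositiveLine n)
    (hL : L.SameReciprocalPosition L' (F.closedCriticalValues V)) :
    ∃ γ : MorsePersistence.dgm (L.restrict (F.persistentHomology 𝕜 i)) ≃
        MorsePersistence.dgm (L'.restrict (F.persistentHomology 𝕜 i)),
      ∀ p : MorsePersistence.dgm (L.restrict (F.persistentHomology 𝕜 i)),
        MorsePersistence.mult (L'.restrict (F.persistentHomology 𝕜 i)) (γ p).1 =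
          MorsePersistence.mult (L.restrict (F.persistentHomology 𝕜 i)) p.1 ∧
        (∃ b, MorsePersistence.IsBar (F.closedCriticalValues V) (L.point p.1.1) b ∧
          L'.point (γ p).1.1 = L'.push b) ∧
        (∀ t : ℝ, p.1.2 = (t : WithTop ℝ) →
          ∃ (t' : ℝ) (b : Fin n → ℝ), (γ p).1.2 = (t' : WithTop ℝ) ∧
            MorsePersistence.IsBar (F.closedCriticalValues V) (L.point t) b ∧
            L'.point t' = L'.push b) ∧
        (p.1.2 = ⊤ → (γ p).1.2 = ⊤) := by
  have hU : SupClosed (F.closedCriticalValues V) := supClosed_supClosure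
  have hfin : (F.closedCriticalValues V).Finite := (F.finite_criticalValues hF).supClosure
  obtain ⟨φ, hφ⟩ := hL.exists_param_eq hU
  obtain ⟨ψ, hψ⟩ := hL.symm.exists_param_eq hU
  -- The bar `b'` of the push of `b` may differ from `b`, but has the same push parameter on `L`;
  -- evaluating `φ` through `b'` instead of `b` gives the push of the bar to `L'`.
  have hbar : ∀ b ∈ F.closedCriticalValues V, ∃ b',
      MorsePersistence.IsBar (F.closedCriticalValues V) (L.point (L.param b)) b' ∧
        L'.point (φ (L.param b)) = L'.push b' := fun b hb => by
    obtain ⟨b', hb', h1, h2⟩ := MorsePersistence.exists_isBar_param_eq hU hfin L hb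
    exact ⟨b', h1, by rw [← h2, hφ b' hb', L'.point_param]⟩
  refine ⟨⟨fun p => ⟨_, (hV.map_mem_dgm hF hFV i hL hφ p.2).1⟩,
    fun p => ⟨_, (hV.map_mem_dgm hF hFV i hL.symm hψ p.2).1⟩,
    fun p => Subtype.ext (hV.map_map_eq hF hFV i hφ hψ p.2),
    fun p => Subtype.ext (hV.map_map_eq hF hFV i hψ hφ p.2)⟩, fun p => ?_⟩
  obtain ⟨b, hb, h1, h2⟩ := hV.exists_eq_param_of_mem_dgm hF hFV i L p.2
  refine ⟨(hV.map_mem_dgm hF hFV i hL hφ p.2).2, ?_, fun t ht => ?_, fun ht => ?_⟩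
  · rw [h1]
    exact h1 ▸ hbar b hb
  · rcases h2 with h2 | ⟨c, hc, h2⟩
    · rw [ht] at h2
      exact absurd h2 (WithTop.coe_ne_top)
    · obtain rfl : t = L.param c := WithTop.coe_injective (ht.symm.trans h2)
      obtain ⟨b', h3, h4⟩ := hbar c hc
      exact ⟨φ (L.param c), b', congrArg (WithTop.map φ) ht, h3, h4⟩
  · exact congrArg (WithTop.map φ) ht
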